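/- Let $\tau$ be in the upper half-plane, $\Lambda=\mathbb Z+\mathbb Z\tau$, $q=e^{2\pi i\tau}$, and let $\wp(\tau,\cdot)$ be the Weierstrass $\wp$-function of $\Lambda$. Let $\eta(\tau)=q^{1/24}\prod_{m\ge1}(1-q^m)$ with $q^{1/24}=e^{2\pi i\tau/24}$, and $$\theta_1(\tau,z)=i\,q^{1/8}y^{-1/2}\prod_{m\ge1}(1-q^m)(1-yq^{m-1})(1-y^{-1}q^m),\qquad y=e^{2\pi iz},\; q^{1/8}=e^{\pi i\tau/4},\; y^{-1/2}=e^{-\pi iz}.$$ For $k\ge2$ put $$G_{2k}(\tau)=-\frac{(2\pi i)^{2k}B_{2k}}{(2k)!}E_{2k}(\tau),\qquad E_{2k}(\tau)=1-\frac{4k}{B_{2k}}\sum_{n\ge1}\sigma_{2k-1}(n)q^n,$$ where $B_{2k}$ are the Bernoulli numbers and $\sigma_{2k-1}(n)=\sum_{d\mid n}d^{2k-1}$. Let $z\in\mathbb C\setminus\Lambda$. (1) For every $t\in\mathbb C$ with $|t|<|z-l|$ for all $l\in\Lambda$ and $|t|<|l|$ for all $l\in\Lambda\setminus\{0\}$,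 the three series below converge absolutely and $$\exp\Bigl(-2\sum_{n\ge1}\frac{t^{2n}}{(2n)!}\,\frac{\partial^{2n-2}}{\partial z^{2n-2}}\wp(\tau,z)\Bigr)\cdot\exp\Bigl(\sum_{n\ge2}\frac{t^{2n}}{n}G_{2n}(\tau)\Bigr)=1-\wp(\tau,z)\,t^2+\sum_{n\ge2}(2n-1)G_{2n}(\tau)\,t^{2n}.$$ (2) Equivalently, for every $t\in\mathbb C\setminus\Lambda$, $$\wp(\tau,t)-\wp(\tau,z)=-(2\pi)^2\Bigl(\frac{\theta_1(\tau,z)}{\eta(\tau)^3}\Bigr)^{-2}\,\frac{\theta_1(\tau,z+t)\,\theta_1(\tau,z-t)}{\theta_1(\tau,t)\,\theta_1(\tau,-t)}.$$ -/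

import Mathlib

noncomputable section

/-- For `τ` in the upper half-plane, the pair of periods `(1, τ)`, which spans the lattice
`ℤ + ℤτ`. -/
def tauPair (τ : UpperHalfPlane) : PeriodPair where
  ω₁ := 1
  ω₂ := (τ : ℂ)
  indep := by
    rw [LinearIndependent.pair_iff]
    intro a b h
    have him := congrArg Complex.im h
    have hre := congrArg Complex.re h
    simp at him hre
    have hb : b = 0 := him.resolve_right τ.im_ne_zero
    subst hb
    exact ⟨by simpa using hre, rfl⟩

/-- The Weierstrass function `℘(τ, z)` of the lattice `ℤ + ℤτ`. -/
def wp (τ : UpperHalfPlane) (z : ℂ) : ℂ := (tauPair τ).weierstrassP z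

/-- The nome `q = exp(2πiτ)`. -/
def nome (τ : UpperHalfPlane) : ℂ := Complex.exp (2 * Real.pi * Complex.I * τ)

/-- The normalized Eisenstein series of weight `2k` (for `k ≥ 1`),
`E_{2k}(τ) = 1 - (4k / B_{2k}) ∑_{n ≥ 1} σ_{2k-1}(n) q^n`. -/
def eisE (k : ℕ) (τ : UpperHalfPlane) : ℂ :=
  1 - (4 * (k : ℂ) / (bernoulli (2 * k) : ℂ)) *
    ∑' n : ℕ+, (ArithmeticFunction.sigma (2 * k - 1) (n : ℕ) : ℂ) * nome τ ^ (n : ℕ)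

/-- `G_{2k}(τ) = - ((2πi)^{2k} B_{2k} / (2k)!) E_{2k}(τ)`; the argument `k` is half the weight. -/
def eisG (k : ℕ) (τ : UpperHalfPlane) : ℂ :=
  -((2 * Real.pi * Complex.I) ^ (2 * k) * (bernoulli (2 * k) : ℂ) / (Nat.factorial (2 * k) : ℂ)) *
    eisE k τ

/-- The theta function
`θ₁(τ, z) = i q^{1/8} y^{-1/2} ∏_{m ≥ 1} (1 - q^m) (1 - y q^{m-1}) (1 - y⁻¹ q^m)`,
where `y = exp(2πiz)`, `q^{1/8} = exp(πiτ/4)` and `y^{-1/2} = exp(-πiz)`. The product index below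
is `m - 1`. -/
def theta₁ (τ : UpperHalfPlane) (z : ℂ) : ℂ :=
  Complex.I * Complex.exp (Real.pi * Complex.I * τ / 4) * Complex.exp (-(Real.pi * Complex.I * z)) *
    ∏' m : ℕ, ((1 - nome τ ^ (m + 1)) *
      (1 - Complex.exp (2 * Real.pi * Complex.I * z) * nome τ ^ m) *
      (1 - (Complex.exp (2 * Real.pi * Complex.I * z))⁻¹ * nome τ ^ (m + 1)))

end

open Complex Filter Topology
open scoped PeriodPair

/-! ### Liouville's theorem for a period lattice -/

namespace PeriodPair

variable (L : PeriodPair)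

/-! Write `φ t = θ₁(t)/t`. Both statements come from Liouville's theorem applied to combinations of
`θ₁` and `℘`. For (2), `θ₁'(0)² θ₁(z+t) θ₁(z-t) / (θ₁(z)² θ₁(t)²) - ℘(t)` is elliptic in `t` and its
pole at `0` cancels, so it is constant; at `t = z` it equals `-℘(z)` (`wp_sub_wp`). The constant in
(2) is then `θ₁'(0) = 2πη³`.

For (1), Liouville also gives `(log θ₁)'' = κ - ℘` for a constant `κ`
(`exists_deriv_logDeriv_theta₁`). Integrating Taylor series twice identifies the first exponential
with `e^{-κt²} θ₁(z+t) θ₁(z-t) / θ₁(z)²` and the second with `e^{κt²} θ₁'(0)² / φ(t)²`. In the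
product `κ` cancels, and by (2) what remains is `t² (℘(t) - ℘(z))`, whose expansion at `0` is the
right-hand side. -/

theorem periodic_of_add_periods {f : ℂ → ℂ} (h₁ : ∀ z ∉ L.lattice, f (z + L.ω₁) = f z)
    (h₂ : ∀ z ∉ L.lattice, f (z + L.ω₂) = f z) {l : ℂ} (hl : l ∈ L.lattice) :
    ∀ z ∉ L.lattice, f (z + l) = f z := by
  have hadd {z l : ℂ} (hz : z ∉ L.lattice) (hl : l ∈ L.lattice) : z + l ∉ L.lattice := fun h ↦
    hz ((L.lattice.add_mem_iff_left hl).mp h)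
  have hneg {l : ℂ} (hl : l ∈ L.lattice) (h : ∀ z ∉ L.lattice, f (z + l) = f z) :
      ∀ z ∉ L.lattice, f (z + -l) = f z := fun z hz ↦ by
    rw [← h _ (hadd hz (neg_mem hl)), neg_add_cancel_right]
  induction hl using Submodule.span_induction with
  | mem x hx =>
    rcases hx with rfl | rfl
    exacts [h₁, h₂]
  | zero => simp
  | add x y hx hy ihx ihy =>
    intro z hz
    rw [← add_assoc, ihy _ (hadd hz hx), ihx _ hz]
  | smul a x hx ih =>
    induction a with
    | zero => simp
    | succ n ihn =>
      intro z hz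
      rw [add_smul, one_smul, ← add_assoc, ih _ (hadd hz (L.lattice.smul_mem _ hx)), ihn _ hz]
    | pred n ihn =>
      intro z hz
      rw [sub_smul, one_smul, sub_eq_add_neg, ← add_assoc,
        hneg hx ih _ (hadd hz (L.lattice.smul_mem _ hx)), ihn _ hz]

/-- Liouville's theorem for an elliptic function whose singularities are removable. -/
theorem eq_of_periodic_of_eventuallyEq_analyticAt {f g : ℂ → ℂ}
    (hf : DifferentiableOn ℂ f (L.lattice : Set ℂ)ᶜ)
    (h₁ : ∀ z ∉ L.lattice, f (z + L.ω₁) = f z) (h₂ : ∀ z ∉ L.lattice, f (z + L.ω₂) = f z)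
    (hg : AnalyticAt ℂ g 0) (hfg : f =ᶠ[𝓝[≠] 0] g) {z : ℂ} (hz : z ∉ L.lattice) :
    f z = g 0 := by
  classical
  let F : ℂ → ℂ := fun z ↦ if z ∈ L.lattice then g 0 else f z
  have hper (l : ℂ) (hl : l ∈ L.lattice) (z : ℂ) : F (z + l) = F z := by
    simp only [F, L.lattice.add_mem_iff_left hl]
    split_ifs with h
    · rfl
    · exact L.periodic_of_add_periods h₁ h₂ hl z h
  have hF0 : DifferentiableAt ℂ F 0 := by
    refine hg.differentiableAt.congr_of_eventuallyEq ?_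
    filter_upwards [eventually_nhdsWithin_iff.mp hfg,
      L.compl_lattice_sdiff_singleton_mem_nhds 0] with w hw hw'
    by_cases h0 : w = 0
    · simp [F, h0]
    · have : w ∉ L.lattice := fun h ↦ hw' ⟨h, h0⟩
      simp only [F, this, if_false]
      exact hw h0
  have hF : Differentiable ℂ F := by
    intro w
    by_cases hw : w ∈ L.lattice
    · have h : F = fun x ↦ F (x - w) := by
        ext x
        rw [sub_eq_add_neg, hper _ (neg_mem hw)]
      rw [h]
      refine DifferentiableAt.comp w (f := fun x ↦ x - w) (g := F) ?_ (by fun_prop)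
      simpa using hF0
    · have hn := L.isClosed_lattice.isOpen_compl.mem_nhds hw
      refine (hf.differentiableAt hn).congr_of_eventuallyEq ?_
      filter_upwards [hn] with x hx
      exact if_neg hx
  have := hF.apply_eq_apply_of_bounded (IsZLattice.isCompact_range_of_periodic L.lattice _
    hF.continuous fun z w hw ↦ hper w hw z).isBounded z 0
  simpa [F, hz] using this

end PeriodPair

/-! ### The infinite q-Pochhammer product -/

/-- The product `∏ₘ (1 - x q ^ m)` over `m ≥ 0`. -/
noncomputable def qPochhammerInf (q x : ℂ) : ℂ := ∏' m : ℕ, (1 - x * q ^ m)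

theorem summable_norm_mul_pow {q : ℂ} (hq : ‖q‖ < 1) (x : ℂ) :
    Summable fun m : ℕ ↦ ‖-(x * q ^ m)‖ := by
  simpa using (summable_geometric_of_lt_one (norm_nonneg q) hq).mul_left ‖x‖

theorem multipliable_one_sub_mul_pow {q : ℂ} (hq : ‖q‖ < 1) (x : ℂ) :
    Multipliable fun m : ℕ ↦ 1 - x * q ^ m := by
  simpa [sub_eq_add_neg] using multipliable_one_add_of_summable (summable_norm_mul_pow hq x)

theorem qPochhammerInf_eq_mul {q : ℂ} (hq : ‖q‖ < 1) (x : ℂ) :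
    qPochhammerInf q x = (1 - x) * qPochhammerInf q (q * x) := by
  have h := multipliable_one_sub_mul_pow hq (q * x)
  rw [qPochhammerInf, tprod_eq_zero_mul']
  · simp only [pow_zero, mul_one, qPochhammerInf]
    congr! 4 with m
    ring
  · convert h using 3
    ring

theorem qPochhammerInf_ne_zero {q x : ℂ} (hq : ‖q‖ < 1) (hx : ∀ m : ℕ, x * q ^ m ≠ 1) :
    qPochhammerInf q x ≠ 0 := by
  have := tprod_one_add_ne_zero_of_summable (f := fun m : ℕ ↦ -(x * q ^ m))
    (fun m ↦ by simpa [← sub_eq_add_neg, sub_eq_zero] using (hx m).symm)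
    (summable_norm_mul_pow hq x)
  simpa [qPochhammerInf, sub_eq_add_neg] using this

theorem differentiable_qPochhammerInf {q : ℂ} (hq : ‖q‖ < 1) :
    Differentiable ℂ (qPochhammerInf q) := by
  intro x
  have h : HasProdLocallyUniformlyOn (fun (m : ℕ) x ↦ 1 + -(x * q ^ m))
      (fun x ↦ ∏' m : ℕ, (1 + -(x * q ^ m))) (Metric.ball 0 (‖x‖ + 1)) := by
    refine Summable.hasProdLocallyUniformlyOn_nat_one_add Metric.isOpen_ball
      ((summable_geometric_of_lt_one (norm_nonneg q) hq).mul_left (‖x‖ + 1))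
      (.of_forall fun m y hy ↦ ?_) (fun _ ↦ by fun_prop)
    have : ‖y‖ < ‖x‖ + 1 := by simpa using hy
    simp only [norm_neg, norm_mul, norm_pow]
    gcongr
  have hd := h.differentiableOn (.of_forall fun s ↦ by
    simpa [Finset.prod_fn] using DifferentiableOn.finsetProd (fun _ _ ↦ by fun_prop))
    Metric.isOpen_ball
  have := hd.differentiableAt (Metric.isOpen_ball.mem_nhds (by simp : x ∈ Metric.ball 0 (‖x‖ + 1)))
  have he : qPochhammerInf q = fun x ↦ ∏' m : ℕ, (1 + -(x * q ^ m)) := by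
    ext
    simp [qPochhammerInf, sub_eq_add_neg]
  rwa [he]

/-! ### The theta function: quasi-periodicity, zeros, derivative at `0` -/

section Theta

variable (τ : UpperHalfPlane)

theorem norm_nome_lt_one : ‖nome τ‖ < 1 := UpperHalfPlane.norm_exp_two_pi_I_lt_one τ

theorem mem_tauPair_lattice {z : ℂ} : z ∈ (tauPair τ).lattice ↔ ∃ m n : ℤ, m + n * (τ : ℂ) = z := by
  simp [PeriodPair.mem_lattice, tauPair]

theorem theta₁_eq (z : ℂ) :
    theta₁ τ z = I * cexp (Real.pi * I * τ / 4) * cexp (-(Real.pi * I * z)) *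
      (qPochhammerInf (nome τ) (nome τ) * qPochhammerInf (nome τ) (cexp (2 * Real.pi * I * z)) *
        qPochhammerInf (nome τ) (nome τ * (cexp (2 * Real.pi * I * z))⁻¹)) := by
  have h := multipliable_one_sub_mul_pow (norm_nome_lt_one τ)
  rw [theta₁, qPochhammerInf, qPochhammerInf, qPochhammerInf, ← (h _).tprod_mul (h _),
    ← ((h _).mul (h _)).tprod_mul (h _)]
  congr! 4 with m
  · ring
  · ring

theorem differentiable_theta₁ : Differentiable ℂ (theta₁ τ) := by
  have h := differentiable_qPochhammerInf (norm_nome_lt_one τ)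
  have h₁ : Differentiable ℂ fun z ↦ qPochhammerInf (nome τ) (cexp (2 * Real.pi * I * z)) :=
    h.comp (by fun_prop)
  have h₂ : Differentiable ℂ fun z ↦
      qPochhammerInf (nome τ) (nome τ * (cexp (2 * Real.pi * I * z))⁻¹) := by
    simp_rw [← Complex.exp_neg]
    exact h.comp (by fun_prop)
  rw [funext (theta₁_eq τ)]
  fun_prop

/-- Splitting off the first factors leaves only `1 - y⁻¹ = -y⁻¹ (1 - y)`. Both the oddness of `θ₁`
and its behaviour under `z ↦ z + τ` reduce to this. -/
theorem qPochhammerInf_mul_swap {q y : ℂ} (hq : ‖q‖ < 1) (hy : y ≠ 0) :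
    qPochhammerInf q (q * y) * qPochhammerInf q y⁻¹ =
      -y⁻¹ * (qPochhammerInf q y * qPochhammerInf q (q * y⁻¹)) := by
  rw [qPochhammerInf_eq_mul hq y, qPochhammerInf_eq_mul hq y⁻¹]
  field_simp
  ring

theorem theta₁_neg (z : ℂ) : theta₁ τ (-z) = -theta₁ τ z := by
  have h := qPochhammerInf_mul_swap (norm_nome_lt_one τ) (Complex.exp_ne_zero (2 * Real.pi * I * z))
  have he : cexp (2 * Real.pi * I * -z) = (cexp (2 * Real.pi * I * z))⁻¹ := by
    rw [← Complex.exp_neg]; ring_nf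
  have hs : cexp (-(Real.pi * I * -z)) = cexp (-(Real.pi * I * z)) * cexp (2 * Real.pi * I * z) := by
    rw [← Complex.exp_add]; ring_nf
  rw [theta₁_eq, theta₁_eq, he, hs, inv_inv]
  have := Complex.exp_ne_zero (2 * Real.pi * I * z)
  rw [show ∀ a b c d e f g : ℂ, a * b * (c * d) * (e * f * g) = a * b * c * e * d * (g * f) by
    intros; ring, h]
  field_simp

theorem theta₁_zero : theta₁ τ 0 = 0 := by
  have := theta₁_neg τ 0
  rwa [neg_zero, eq_neg_iff_add_eq_zero, add_self_eq_zero] at this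

theorem theta₁_add_one (z : ℂ) : theta₁ τ (z + 1) = -theta₁ τ z := by
  have he : cexp (2 * Real.pi * I * (z + 1)) = cexp (2 * Real.pi * I * z) := by
    rw [mul_add, mul_one, Complex.exp_add, Complex.exp_two_pi_mul_I, mul_one]
  have hs : cexp (-(Real.pi * I * (z + 1))) = -cexp (-(Real.pi * I * z)) := by
    rw [mul_add, mul_one, neg_add, Complex.exp_add, Complex.exp_neg (_ * I), Complex.exp_pi_mul_I]
    norm_num
  rw [theta₁_eq, theta₁_eq, he, hs]
  ring

theorem theta₁_add_tau (z : ℂ) :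
    theta₁ τ (z + τ) = -cexp (-(Real.pi * I * τ) - 2 * Real.pi * I * z) * theta₁ τ z := by
  have h := qPochhammerInf_mul_swap (norm_nome_lt_one τ) (Complex.exp_ne_zero (2 * Real.pi * I * z))
  have he : cexp (2 * Real.pi * I * (z + τ)) = nome τ * cexp (2 * Real.pi * I * z) := by
    rw [nome, ← Complex.exp_add]; ring_nf
  have hs : cexp (-(Real.pi * I * (z + τ))) = cexp (-(Real.pi * I * z)) * cexp (-(Real.pi * I * τ)) := by
    rw [← Complex.exp_add]; ring_nf
  have hn : nome τ ≠ 0 := Complex.exp_ne_zero _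
  have hi : nome τ * (nome τ * cexp (2 * Real.pi * I * z))⁻¹ = (cexp (2 * Real.pi * I * z))⁻¹ := by
    have := Complex.exp_ne_zero (2 * Real.pi * I * z)
    field_simp
  rw [theta₁_eq, theta₁_eq, he, hs, hi, mul_assoc (qPochhammerInf (nome τ) (nome τ)), h,
    sub_eq_add_neg, Complex.exp_add, Complex.exp_neg (2 * Real.pi * I * z)]
  ring

/-- A convergent product vanishes only if a factor does, and a vanishing factor means `e^{2πi(z +
mτ)} = 1` for some integer `m`. -/
theorem theta₁_ne_zero {z : ℂ} (hz : z ∉ (tauPair τ).lattice) : theta₁ τ z ≠ 0 := by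
  have key (m : ℤ) (h : cexp (2 * Real.pi * I * (z + m * τ)) = 1) : False := by
    obtain ⟨n, hn⟩ := Complex.exp_eq_one_iff.mp h
    refine hz ((mem_tauPair_lattice τ).mpr ⟨n, -m, ?_⟩)
    have : z + m * τ = n := by
      apply mul_left_cancel₀ Complex.two_pi_I_ne_zero
      rw [hn]; ring
    push_cast
    linear_combination -this
  have hq := norm_nome_lt_one τ
  rw [theta₁_eq]
  refine mul_ne_zero (mul_ne_zero (mul_ne_zero I_ne_zero (exp_ne_zero _)) (exp_ne_zero _))
    (mul_ne_zero (mul_ne_zero ?_ ?_) ?_)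
  · refine qPochhammerInf_ne_zero hq fun m h ↦ ?_
    rw [← pow_succ'] at h
    have := congrArg norm h
    rw [norm_pow, norm_one] at this
    exact (pow_lt_one₀ (norm_nonneg _) hq (by omega)).ne this
  · refine qPochhammerInf_ne_zero hq fun m h ↦ key m ?_
    rw [← h, nome, ← Complex.exp_nat_mul, ← Complex.exp_add]
    push_cast; ring_nf
  · refine qPochhammerInf_ne_zero hq fun m h ↦ key (-(m + 1)) ?_
    rw [← inv_eq_one, ← Complex.exp_neg, ← h, mul_right_comm (nome τ), ← pow_succ', nome,
      ← Complex.exp_nat_mul, ← Complex.exp_neg, ← Complex.exp_add]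
    push_cast; ring_nf

theorem eta_pow_three :
    ModularForm.eta (τ : ℂ) ^ 3 =
      cexp (Real.pi * I * τ / 4) * qPochhammerInf (nome τ) (nome τ) ^ 3 := by
  rw [ModularForm.eta, mul_pow, Function.Periodic.qParam, ← Complex.exp_nat_mul]
  congr 2
  · push_cast; ring_nf
  · simp_rw [qPochhammerInf, ModularForm.eta_q_eq_pow, nome, pow_succ']

theorem eta_ne_zero : ModularForm.eta (τ : ℂ) ≠ 0 := ModularForm.eta_ne_zero τ.2

/-- The factor `1 - y` carries the zero at `z = 0`, so the derivative is `-2πi` times the cofactor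
`g` at `0`. -/
theorem deriv_theta₁_zero : deriv (theta₁ τ) 0 = 2 * Real.pi * ModularForm.eta (τ : ℂ) ^ 3 := by
  have hq := norm_nome_lt_one τ
  have h := differentiable_qPochhammerInf hq
  let g : ℂ → ℂ := fun z ↦ I * cexp (Real.pi * I * τ / 4) * cexp (-(Real.pi * I * z)) *
      (qPochhammerInf (nome τ) (nome τ) *
        qPochhammerInf (nome τ) (nome τ * cexp (2 * Real.pi * I * z)) *
        qPochhammerInf (nome τ) (nome τ * cexp (-(2 * Real.pi * I * z))))
  have hg : Differentiable ℂ g := by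
    have h₁ : Differentiable ℂ fun z ↦
        qPochhammerInf (nome τ) (nome τ * cexp (2 * Real.pi * I * z)) := h.comp (by fun_prop)
    have h₂ : Differentiable ℂ fun z ↦
        qPochhammerInf (nome τ) (nome τ * cexp (-(2 * Real.pi * I * z))) := h.comp (by fun_prop)
    fun_prop
  have hθ : theta₁ τ = fun z ↦ (1 - cexp (2 * Real.pi * I * z)) * g z := by
    ext z
    rw [theta₁_eq, qPochhammerInf_eq_mul hq (cexp (2 * Real.pi * I * z))]
    simp only [g, Complex.exp_neg]
    ring
  have hd : HasDerivAt (fun z : ℂ ↦ 1 - cexp (2 * Real.pi * I * z)) (-(2 * Real.pi * I)) 0 := by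
    have := (((hasDerivAt_id (0 : ℂ)).const_mul (2 * Real.pi * I : ℂ)).cexp).const_sub 1
    simpa using this
  rw [hθ, (hd.fun_mul (hg 0).hasDerivAt).deriv, eta_pow_three]
  simp only [g, mul_zero, neg_zero, Complex.exp_zero, mul_one, sub_self, zero_mul, add_zero]
  linear_combination (-2 * Real.pi * cexp (Real.pi * I * τ / 4) *
    qPochhammerInf (nome τ) (nome τ) ^ 3) * I_sq

end Theta

/-! ### Eisenstein series as lattice sums -/

theorem eisG_eq_G (τ : UpperHalfPlane) {k : ℕ} (hk : 2 ≤ k) :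
    eisG k τ = (tauPair τ).G (2 * k) := by
  have h := tsum_eisSummand_eq_tsum_sigma_mul_cexp_pow (k := 2 * k) (by omega) (even_two_mul k) τ
  have hG : (tauPair τ).G (2 * k) = ∑' v, EisensteinSeries.eisSummand (2 * k : ℕ) v τ := by
    -- The swap is needed because `eisSummand` puts the coefficient of `τ` first, while the period
    -- pair is `(1, τ)`.
    rw [PeriodPair.G, ← (tauPair τ).latticeEquivProd.symm.toEquiv.tsum_eq,
      ← (finTwoArrowEquiv ℤ).symm.tsum_eq, ← (Equiv.prodComm ℤ ℤ).tsum_eq]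
    congr! 2 with v
    have hv := (tauPair τ).latticeEquiv_symm_apply v.swap
    rw [EisensteinSeries.eisSummand, zpow_neg, zpow_natCast, LinearEquiv.coe_toEquiv,
      Equiv.prodComm_apply, hv]
    simp [tauPair, add_comm]
  have hz := riemannZeta_two_mul_nat (show k ≠ 0 by omega)
  -- By Euler's formula `hz`, a vanishing Bernoulli number would force `ζ(2k) = 0`.
  have hB : (bernoulli (2 * k) : ℂ) ≠ 0 := by
    intro h0
    rw [h0] at hz
    refine riemannZeta_ne_zero_of_one_lt_re (s := 2 * k) ?_ (by simpa using hz)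
    norm_cast
    omega
  have hp : (2 * Real.pi * I : ℂ) ^ (2 * k) = (-1) ^ k * 2 ^ (2 * k) * Real.pi ^ (2 * k) := by
    rw [mul_pow, mul_pow, pow_mul I, I_sq]
    ring
  have hp' : (-2 * Real.pi * I : ℂ) ^ (2 * k) = (2 * Real.pi * I : ℂ) ^ (2 * k) := by
    rw [neg_mul, neg_mul, (even_two_mul k).neg_pow]
  have hf : ((2 * k).factorial : ℂ) = 2 * k * (2 * k - 1).factorial := by
    rw [← Nat.mul_factorial_pred (by omega : 2 * k ≠ 0)]
    push_cast
    rfl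
  have h2 : (2 : ℂ) ^ (2 * k) = 2 * 2 ^ (2 * k - 1) := by
    rw [← pow_succ']
    congr 1
    omega
  have hf' : ((2 * k - 1).factorial : ℂ) ≠ 0 := by exact_mod_cast Nat.factorial_ne_zero _
  have hk0 : (k : ℂ) ≠ 0 := by
    norm_cast
    omega
  rw [hG, h, eisG, eisE, hp', Nat.cast_mul, Nat.cast_two, hz, hp, hf, h2]
  simp only [nome]
  field_simp
  ring

/-! ### Even functions and their logarithms -/

section EvenFunctions

theorem deriv_zero_of_even {f : ℂ → ℂ} (hf : ∀ t, f (-t) = f t) : deriv f 0 = 0 := by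
  have := deriv_comp_neg f 0
  rw [funext hf, neg_zero] at this
  exact self_eq_neg.mp this

theorem iteratedDeriv_zero_of_even {f : ℂ → ℂ} (hf : ∀ t, f (-t) = f t) {n : ℕ} (hn : Odd n) :
    iteratedDeriv n f 0 = 0 := by
  have := iteratedDeriv_comp_neg n f 0
  rw [funext hf, neg_zero, hn.neg_one_pow, neg_smul, one_smul] at this
  exact self_eq_neg.mp this

theorem differentiable_dslope {f : ℂ → ℂ} (hf : Differentiable ℂ f) (c : ℂ) :
    Differentiable ℂ (dslope f c) := by
  rw [← differentiableOn_univ]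
  exact (Complex.differentiableOn_dslope univ_mem).mpr hf.differentiableOn

theorem exists_eq_sq_mul_of_even {f : ℂ → ℂ} (hf : Differentiable ℂ f)
    (heven : ∀ t, f (-t) = f t) (h0 : f 0 = 0) :
    ∃ g : ℂ → ℂ, Differentiable ℂ g ∧ ∀ t, f t = t ^ 2 * g t := by
  refine ⟨dslope (dslope f 0) 0, differentiable_dslope (differentiable_dslope hf 0) 0, fun t ↦ ?_⟩
  have h₁ := sub_smul_dslope f 0 t
  have h₂ := sub_smul_dslope (dslope f 0) 0 t
  rw [dslope_same, deriv_zero_of_even heven] at h₂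
  simp only [sub_zero, smul_eq_mul, h0] at h₁ h₂
  rw [← h₁, ← h₂]
  ring

theorem hasSum_even_taylorSeries {f : ℂ → ℂ} {r : ℝ} (hf : DifferentiableOn ℂ f (Metric.ball 0 r))
    (h0 : f 0 = 0) (hodd : ∀ n, Odd n → iteratedDeriv n f 0 = 0) {t : ℂ}
    (ht : t ∈ Metric.ball 0 r) :
    HasSum (fun n : ℕ ↦ t ^ (2 * (n + 1)) / ((2 * (n + 1)).factorial : ℂ) *
      iteratedDeriv (2 * (n + 1)) f 0) (f t) := by
  have h := hasSum_taylorSeries_on_ball hf ht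
  have hinj : Function.Injective fun n : ℕ ↦ 2 * (n + 1) := fun a b h ↦ by
    simp only at h
    omega
  rw [← hinj.hasSum_iff] at h
  · refine h.congr_fun fun n ↦ ?_
    simp [div_eq_inv_mul, mul_assoc]
  · intro n hn
    rcases Nat.even_or_odd' n with ⟨m, rfl | rfl⟩
    · rcases m with _ | m
      · simp [h0]
      · exact absurd ⟨m, rfl⟩ hn
    · simp [hodd _ (odd_two_mul_add_one m)]

/-- A nonvanishing even function on a disc has a logarithm there, with an explicit expansion in
terms of the derivatives of the second logarithmic derivative. -/
theorem exists_log_hasSum_of_even {f h : ℂ → ℂ} {r : ℝ} (hr : 0 < r)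
    (hf : DifferentiableOn ℂ f (Metric.ball 0 r)) (hne : ∀ t ∈ Metric.ball (0 : ℂ) r, f t ≠ 0)
    (h1 : f 0 = 1) (heven : ∀ t, f (-t) = f t) (hheven : ∀ t, h (-t) = h t)
    (hh : deriv (logDeriv f) =ᶠ[𝓝 0] h) {t : ℂ} (ht : t ∈ Metric.ball 0 r) :
    ∃ b : ℂ, cexp b = f t ∧ HasSum (fun n : ℕ ↦ t ^ (2 * (n + 1)) /
      ((2 * (n + 1)).factorial : ℂ) * iteratedDeriv (2 * n) h 0) b := by
  have hld : DifferentiableOn ℂ (logDeriv f) (Metric.ball 0 r) :=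
    (hf.deriv Metric.isOpen_ball).div hf hne
  obtain ⟨b, hb0, hb⟩ := hld.isExactOn_ball.with_val_at 0 0
  have hbd : DifferentiableOn ℂ b (Metric.ball 0 r) := fun x hx ↦
    (hb x hx).differentiableAt.differentiableWithinAt
  have h0mem : (0 : ℂ) ∈ Metric.ball 0 r := by simpa
  have hexp (x : ℂ) (hx : x ∈ Metric.ball 0 r) : cexp (b x) = f x := by
    have hd (y : ℂ) (hy : y ∈ Metric.ball 0 r) :
        HasDerivAt (fun x ↦ cexp (-b x) * f x) 0 y := by
      have h₁ := ((hb y hy).neg.cexp).fun_mul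
        (hf.differentiableAt (Metric.isOpen_ball.mem_nhds hy)).hasDerivAt
      convert! h₁ using 1
      rw [logDeriv_apply]
      have := hne y hy
      field_simp
      ring
    have := Metric.isOpen_ball.is_const_of_deriv_eq_zero
      (convex_ball (0 : ℂ) r).isPreconnected
      (fun y hy ↦ (hd y hy).differentiableAt.differentiableWithinAt)
      (fun y hy ↦ (hd y hy).deriv) hx h0mem
    rw [hb0, h1, neg_zero, Complex.exp_zero, mul_one, Complex.exp_neg] at this
    exact (inv_mul_eq_one₀ (exp_ne_zero _)).mp this
  have hderiv : deriv b =ᶠ[𝓝 0] logDeriv f := by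
    filter_upwards [Metric.isOpen_ball.mem_nhds h0mem] with x hx using (hb x hx).deriv
  -- Since `b'' = h` near `0`, the Taylor coefficients of `b` from degree 2 on are read off from
  -- `h`.
  have hiter (n : ℕ) : iteratedDeriv (n + 2) b 0 = iteratedDeriv n h 0 := by
    rw [iteratedDeriv_succ', iteratedDeriv_succ']
    exact (hderiv.deriv.trans hh).iteratedDeriv_eq n
  refine ⟨b t, hexp t ht, ?_⟩
  refine (hasSum_even_taylorSeries hbd hb0 (fun n hn ↦ ?_) ht).congr_fun fun n ↦ ?_
  · obtain ⟨m, rfl⟩ := hn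
    rcases m with _ | m
    · rw [mul_zero, zero_add, iteratedDeriv_one, hderiv.eq_of_nhds, logDeriv_apply,
        deriv_zero_of_even heven, zero_div]
    · rw [show 2 * (m + 1) + 1 = 2 * m + 1 + 2 by ring, hiter,
        iteratedDeriv_zero_of_even hheven (odd_two_mul_add_one m)]
  · rw [mul_add_one 2 n, hiter]

end EvenFunctions

/-! ### `℘` in terms of theta functions -/

section Elliptic

variable (τ : UpperHalfPlane)

local notation "φ" => dslope (theta₁ τ) 0

theorem theta₁_eq_mul_dslope (t : ℂ) : theta₁ τ t = t * φ t := by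
  have := sub_smul_dslope (theta₁ τ) 0 t
  simpa [theta₁_zero] using this.symm

theorem dslope_theta₁_neg (t : ℂ) : φ (-t) = φ t := by
  rcases eq_or_ne t 0 with rfl | ht
  · simp
  · have h := theta₁_neg τ t
    rw [theta₁_eq_mul_dslope, theta₁_eq_mul_dslope, neg_mul, neg_inj] at h
    exact mul_left_cancel₀ ht h

theorem deriv_theta₁_zero_ne_zero : deriv (theta₁ τ) 0 ≠ 0 := by
  rw [deriv_theta₁_zero]
  exact mul_ne_zero (mul_ne_zero two_ne_zero (ofReal_ne_zero.mpr Real.pi_ne_zero))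
    (pow_ne_zero 3 (eta_ne_zero τ))

theorem differentiable_dslope_theta₁ : Differentiable ℂ φ :=
  differentiable_dslope (differentiable_theta₁ τ) 0

theorem wp_eq_weierstrassPExcept_add (t : ℂ) :
    wp τ t = (tauPair τ).weierstrassPExcept 0 t + 1 / t ^ 2 := by
  have := (tauPair τ).weierstrassPExcept_add 0 t
  simpa [wp] using this.symm

theorem wp_add_one (t : ℂ) : wp τ (t + 1) = wp τ t :=
  (tauPair τ).weierstrassP_add_coe t ⟨1, (tauPair τ).ω₁_mem_lattice⟩

theorem wp_add_tau (t : ℂ) : wp τ (t + τ) = wp τ t :=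
  (tauPair τ).weierstrassP_add_coe t ⟨τ, (tauPair τ).ω₂_mem_lattice⟩

/-- The difference of two values of `℘` as a quotient of theta functions. -/
theorem wp_sub_wp {z t : ℂ} (hz : z ∉ (tauPair τ).lattice) (ht : t ∉ (tauPair τ).lattice) :
    wp τ t - wp τ z = deriv (theta₁ τ) 0 ^ 2 * (theta₁ τ (z + t) * theta₁ τ (z - t)) /
      (theta₁ τ z ^ 2 * theta₁ τ t ^ 2) := by
  have hθz := theta₁_ne_zero τ hz
  have hθ := differentiable_theta₁ τ
  have hφ := differentiable_dslope_theta₁ τ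
  set d := deriv (theta₁ τ) 0 with hd
  -- Normalized so that `N 0 = d² = φ(0)²`. The even function `N - φ²` then has a double zero at
  -- `0`, so `N / θ₁² - 1/t²` has no pole there.
  let N : ℂ → ℂ := fun t ↦ d ^ 2 / theta₁ τ z ^ 2 * (theta₁ τ (z + t) * theta₁ τ (z - t))
  have hN : Differentiable ℂ N := by
    have h₁ : Differentiable ℂ fun t ↦ theta₁ τ (z + t) := hθ.comp (by fun_prop)
    have h₂ : Differentiable ℂ fun t ↦ theta₁ τ (z - t) := hθ.comp (by fun_prop)
    fun_prop
  obtain ⟨g, hg, hgM⟩ := exists_eq_sq_mul_of_even (f := fun t ↦ N t - φ t ^ 2) (by fun_prop)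
    (fun t ↦ by simp only [N, dslope_theta₁_neg, ← sub_eq_add_neg, sub_neg_eq_add, mul_comm])
    (by
      simp only [N, add_zero, sub_zero, dslope_same, ← hd]
      field_simp
      ring)
  let f : ℂ → ℂ := fun t ↦ N t / theta₁ τ t ^ 2 - wp τ t
  have hsub (a b : ℂ) : theta₁ τ (a - b) = -theta₁ τ (b - a) := by rw [← theta₁_neg, neg_sub]
  have hf : DifferentiableOn ℂ f ((tauPair τ).lattice : Set ℂ)ᶜ :=
    (hN.differentiableOn.div (hθ.differentiableOn.pow 2)
      fun x hx ↦ pow_ne_zero 2 (theta₁_ne_zero τ hx)).sub (tauPair τ).differentiableOn_weierstrassP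
  have h₁ (t : ℂ) (_ : t ∉ (tauPair τ).lattice) : f (t + 1) = f t := by
    simp only [f, N, wp_add_one, hsub z]
    rw [← add_assoc, add_sub_right_comm, theta₁_add_one, theta₁_add_one, theta₁_add_one]
    ring
  have h₂ (t : ℂ) (ht : t ∉ (tauPair τ).lattice) : f (t + τ) = f t := by
    simp only [f, N, wp_add_tau, hsub z]
    rw [← add_assoc, add_sub_right_comm, theta₁_add_tau, theta₁_add_tau, theta₁_add_tau]
    -- The multipliers in numerator and denominator agree because `(z + t) + (t - z) = 2t`.
    have he : cexp (-(Real.pi * I * τ) - 2 * Real.pi * I * (z + t)) *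
        cexp (-(Real.pi * I * τ) - 2 * Real.pi * I * (t - z)) =
        cexp (-(Real.pi * I * τ) - 2 * Real.pi * I * t) ^ 2 := by
      rw [← Complex.exp_add, ← Complex.exp_nat_mul]
      push_cast; ring_nf
    have := theta₁_ne_zero τ ht
    have := Complex.exp_ne_zero (-(Real.pi * I * τ) - 2 * Real.pi * I * t)
    congr 1
    rw [div_eq_div_iff (by simp_all) (by simp_all)]
    linear_combination -(d ^ 2 / theta₁ τ z ^ 2 * theta₁ τ (z + t) * theta₁ τ (t - z) *
      theta₁ τ t ^ 2) * he
  have hφ0 : φ 0 ≠ 0 := by simpa using deriv_theta₁_zero_ne_zero τ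
  have hga : AnalyticAt ℂ (fun t ↦ g t / φ t ^ 2 - (tauPair τ).weierstrassPExcept 0 t) 0 :=
    ((hg.analyticAt 0).div ((hφ.analyticAt 0).pow 2) (pow_ne_zero 2 hφ0)).sub
      ((tauPair τ).analyticAt_weierstrassPExcept 0)
  have hfg : f =ᶠ[𝓝[≠] 0] fun t ↦ g t / φ t ^ 2 - (tauPair τ).weierstrassPExcept 0 t := by
    filter_upwards [self_mem_nhdsWithin,
      (hφ.continuous.continuousAt.eventually_ne hφ0).filter_mono nhdsWithin_le_nhds] with t ht hφt
    have ht : t ≠ 0 := ht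
    have := hgM t
    simp only [f, wp_eq_weierstrassPExcept_add, theta₁_eq_mul_dslope τ t]
    rw [sub_eq_iff_eq_add] at this
    rw [this]
    field_simp
    ring
  have hc {t : ℂ} := (tauPair τ).eq_of_periodic_of_eventuallyEq_analyticAt hf h₁ h₂ hga hfg (z := t)
  -- At `t = z` the theta quotient vanishes, since `θ₁(0) = 0`; this determines the constant.
  have hzt := (hc ht).trans (hc hz).symm
  simp only [f, N, sub_self, theta₁_zero, mul_zero, zero_div, zero_sub] at hzt
  have hzt' : wp τ t - wp τ z = d ^ 2 / theta₁ τ z ^ 2 *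
      (theta₁ τ (z + t) * theta₁ τ (z - t)) / theta₁ τ t ^ 2 := by linear_combination -hzt
  rw [hzt']
  have := theta₁_ne_zero τ ht
  field_simp

/-- The second logarithmic derivative of the theta function is `-℘` up to a constant. -/
theorem exists_deriv_logDeriv_theta₁ : ∃ κ : ℂ,
    (∀ z ∉ (tauPair τ).lattice, deriv (logDeriv (theta₁ τ)) z = κ - wp τ z) ∧
      ∀ᶠ z in 𝓝 0, deriv (logDeriv φ) z = κ - (tauPair τ).weierstrassPExcept 0 z := by
  have hθ := differentiable_theta₁ τ
  have hφ := differentiable_dslope_theta₁ τ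
  have hφ0 : φ 0 ≠ 0 := by simpa using deriv_theta₁_zero_ne_zero τ
  have hopen := (tauPair τ).isClosed_lattice.isOpen_compl
  have hld : DifferentiableOn ℂ (logDeriv (theta₁ τ)) ((tauPair τ).lattice : Set ℂ)ᶜ :=
    (hθ.deriv.differentiableOn).div hθ.differentiableOn fun x hx ↦ theta₁_ne_zero τ hx
  let f : ℂ → ℂ := fun z ↦ deriv (logDeriv (theta₁ τ)) z + wp τ z
  have hf : DifferentiableOn ℂ f ((tauPair τ).lattice : Set ℂ)ᶜ :=
    (hld.deriv hopen).add (tauPair τ).differentiableOn_weierstrassP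
  have h₁ (t : ℂ) (_ : t ∉ (tauPair τ).lattice) : f (t + 1) = f t := by
    have h : (fun w ↦ logDeriv (theta₁ τ) (w + 1)) = logDeriv (theta₁ τ) := by
      ext w
      rw [logDeriv_apply, logDeriv_apply, ← deriv_comp_add_const,
        funext (theta₁_add_one τ), theta₁_add_one, deriv.fun_neg, neg_div_neg_eq]
    simp only [f, wp_add_one]
    rw [← deriv_comp_add_const, h]
  have h₂ (t : ℂ) (ht : t ∉ (tauPair τ).lattice) : f (t + τ) = f t := by
    -- Translation by `τ` changes the logarithmic derivative by a constant, which the next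
    -- derivative kills.
    have h : (fun w ↦ logDeriv (theta₁ τ) (w + τ)) =ᶠ[𝓝 t]
        fun w ↦ logDeriv (theta₁ τ) w - 2 * Real.pi * I := by
      filter_upwards [hopen.mem_nhds ht] with w hw
      have hw := theta₁_ne_zero τ hw
      have he : HasDerivAt (fun w : ℂ ↦ -cexp (-(Real.pi * I * τ) - 2 * Real.pi * I * w))
          (2 * Real.pi * I * cexp (-(Real.pi * I * τ) - 2 * Real.pi * I * w)) w := by
        have := (((hasDerivAt_id w).const_mul (2 * Real.pi * I : ℂ)).const_sub
          (-(Real.pi * I * τ))).cexp.neg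
        convert! this using 1
        simp
        ring
      rw [logDeriv_apply, logDeriv_apply, ← deriv_comp_add_const,
        funext (theta₁_add_tau τ), theta₁_add_tau, (he.fun_mul (hθ w).hasDerivAt).deriv]
      have := Complex.exp_ne_zero (-(Real.pi * I * τ) - 2 * Real.pi * I * w)
      field_simp
      ring
    simp only [f, wp_add_tau]
    rw [← deriv_comp_add_const, h.deriv_eq, deriv_sub_const]
  have hga : AnalyticAt ℂ (fun z ↦ deriv (logDeriv φ) z + (tauPair τ).weierstrassPExcept 0 z) 0 :=
    (((hφ.analyticAt 0).deriv.div (hφ.analyticAt 0) hφ0).deriv).add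
      ((tauPair τ).analyticAt_weierstrassPExcept 0)
  have hfg : f =ᶠ[𝓝[≠] 0]
      fun z ↦ deriv (logDeriv φ) z + (tauPair τ).weierstrassPExcept 0 z := by
    have hev := (hφ.continuous.continuousAt.eventually_ne hφ0)
    filter_upwards [self_mem_nhdsWithin,
      hev.eventually_nhds.filter_mono nhdsWithin_le_nhds] with t ht hφt
    have ht : t ≠ 0 := ht
    -- The derivative of `w⁻¹` cancels the double pole of `℘`.
    have h : logDeriv (theta₁ τ) =ᶠ[𝓝 t] fun w ↦ w⁻¹ + logDeriv φ w := by
      filter_upwards [hφt, eventually_ne_nhds ht] with w hw hw0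
      have heq : logDeriv (theta₁ τ) w = logDeriv (fun x ↦ x * φ x) w :=
        congrArg (logDeriv · w) (funext (theta₁_eq_mul_dslope τ))
      rw [heq, logDeriv_mul w hw0 hw (by fun_prop) (hφ w)]
      simp [logDeriv_apply]
    have hd : DifferentiableAt ℂ (logDeriv φ) t := (hφ.deriv t).div (hφ t) hφt.self_of_nhds
    simp only [f]
    rw [h.deriv_eq, deriv_fun_add (differentiableAt_inv ht) hd, deriv_inv,
      wp_eq_weierstrassPExcept_add]
    field_simp
    ring
  have hc {t : ℂ} := (tauPair τ).eq_of_periodic_of_eventuallyEq_analyticAt hf h₁ h₂ hga hfg (z := t)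
  refine ⟨_, fun z hz ↦ eq_sub_of_add_eq (hc hz), ?_⟩
  filter_upwards [eventually_nhdsWithin_iff.mp hfg,
    (tauPair τ).compl_lattice_sdiff_singleton_mem_nhds 0] with t ht ht'
  rw [eq_sub_iff_add_eq]
  by_cases h0 : t = 0
  · rw [h0]
  · rw [← hc fun h ↦ ht' ⟨h, h0⟩, ht h0]

end Elliptic

/-! ### Discs of convergence and the Laurent expansion of `℘` -/

/-- The distance to a nonempty closed set is attained, so pointwise strict bounds leave room for an
open disc of larger radius, on which Taylor's theorem applies at `t`. -/
theorem IsClosed.exists_gt_forall_le_dist {s : Set ℂ} (hs : IsClosed s) {x : ℂ} {c : ℝ}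
    (h : ∀ y ∈ s, c < dist x y) : ∃ r > c, ∀ y ∈ s, r ≤ dist x y := by
  rcases s.eq_empty_or_nonempty with rfl | hne
  · exact ⟨c + 1, by simp, by simp⟩
  · obtain ⟨y, hy, hxy⟩ := hs.exists_infDist_eq_dist hne x
    exact ⟨Metric.infDist x s, hxy ▸ h y hy, fun y hy ↦ Metric.infDist_le_dist_of_mem hy⟩

namespace PeriodPair

variable (L : PeriodPair)

theorem hasSum_sq_mul_weierstrassPExcept {r : ℝ} (hL : ∀ l ∈ L.lattice, l ≠ 0 → r ≤ ‖l‖) {t : ℂ}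
    (ht : t ∈ Metric.ball 0 r) :
    HasSum (fun n : ℕ ↦ (2 * ((n : ℂ) + 2) - 1) * L.G (2 * (n + 2)) * t ^ (2 * (n + 2)))
      (t ^ 2 * L.weierstrassPExcept 0 t) := by
  have hd : DifferentiableOn ℂ (L.weierstrassPExcept 0) (Metric.ball 0 r) :=
    (L.differentiableOn_weierstrassPExcept 0).mono fun x hx h ↦ by
      rw [mem_ball_zero_iff] at hx
      exact hx.not_ge (hL x h.1 h.2)
  have h := hasSum_even_taylorSeries hd (by simp) (fun n hn ↦ ?_) ht
  · refine (h.mul_left (t ^ 2)).congr_fun fun n ↦ ?_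
    rw [L.iteratedDeriv_weierstrassPExcept_self, if_neg (by omega), sumInvPow_zero,
      Nat.factorial_succ, show 2 * (n + 2) = 2 * (n + 1) + 2 by ring]
    have : ((2 * (n + 1)).factorial : ℂ) ≠ 0 := by exact_mod_cast Nat.factorial_ne_zero _
    push_cast
    field_simp
    ring
  · rw [L.iteratedDeriv_weierstrassPExcept_self, if_neg hn.pos.ne', sumInvPow_zero,
      L.G_eq_zero_of_odd _ (hn.add_even even_two), mul_zero]

end PeriodPair

/-! ### The two exponentials as theta quotients -/

section Expansion

variable (τ : UpperHalfPlane)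

local notation "φ" => dslope (theta₁ τ) 0

/-- The Gaussian factor removes `κ`: the second logarithmic derivative of the right-hand side is
`-(℘(z+t) + ℘(z-t))`, whose derivative of order `2n` at `t = 0` is `-2 ℘^{(2n)}(z)`. -/
theorem exists_log_theta₁_hasSum {κ : ℂ}
    (hκ : ∀ z ∉ (tauPair τ).lattice, deriv (logDeriv (theta₁ τ)) z = κ - wp τ z) {z : ℂ} {r : ℝ}
    (hr : 0 < r) (hz : ∀ l ∈ (tauPair τ).lattice, r ≤ ‖z - l‖) {t : ℂ}
    (ht : t ∈ Metric.ball 0 r) :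
    ∃ b : ℂ, cexp b = cexp (-(κ * t ^ 2)) *
        (theta₁ τ (z + t) * theta₁ τ (z - t) / theta₁ τ z ^ 2) ∧
      HasSum (fun n : ℕ ↦ t ^ (2 * (n + 1)) / ((2 * (n + 1)).factorial : ℂ) *
        (-2 * iteratedDeriv (2 * n) (wp τ) z)) b := by
  have hθ := differentiable_theta₁ τ
  have hmem {t : ℂ} (ht : t ∈ Metric.ball 0 r) : z + t ∉ (tauPair τ).lattice := fun h ↦ by
    have := hz _ h
    rw [mem_ball_zero_iff] at ht
    rw [sub_add_cancel_left, norm_neg] at this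
    exact ht.not_ge this
  have hmem' {t : ℂ} (ht : t ∈ Metric.ball 0 r) : z - t ∉ (tauPair τ).lattice := by
    rw [sub_eq_add_neg]
    exact hmem (by simpa using ht)
  have h0mem : (0 : ℂ) ∈ Metric.ball 0 r := by simpa
  have hzΛ : z ∉ (tauPair τ).lattice := by simpa using hmem h0mem
  have hθz := theta₁_ne_zero τ hzΛ
  have hopen := (tauPair τ).isClosed_lattice.isOpen_compl
  have h₁ : Differentiable ℂ fun t ↦ theta₁ τ (z + t) := hθ.comp (by fun_prop)
  have h₂ : Differentiable ℂ fun t ↦ theta₁ τ (z - t) := hθ.comp (by fun_prop)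
  have hld : DifferentiableOn ℂ (logDeriv (theta₁ τ)) ((tauPair τ).lattice : Set ℂ)ᶜ :=
    (hθ.deriv.differentiableOn).div hθ.differentiableOn fun x hx ↦ theta₁_ne_zero τ hx
  have hd {x : ℂ} (hx : x ∉ (tauPair τ).lattice) :
      HasDerivAt (logDeriv (theta₁ τ)) (κ - wp τ x) x := by
    rw [← hκ x hx]
    exact (hld.differentiableAt (hopen.mem_nhds hx)).hasDerivAt
  have hh : deriv (logDeriv fun t ↦ cexp (-(κ * t ^ 2)) *
      (theta₁ τ (z + t) * theta₁ τ (z - t) / theta₁ τ z ^ 2)) =ᶠ[𝓝 0]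
      fun t ↦ -(wp τ (z + t) + wp τ (z - t)) := by
    have heq : logDeriv (fun t ↦ cexp (-(κ * t ^ 2)) *
        (theta₁ τ (z + t) * theta₁ τ (z - t) / theta₁ τ z ^ 2)) =ᶠ[𝓝 0] fun t ↦
          -(2 * κ * t) + (logDeriv (theta₁ τ) (z + t) - logDeriv (theta₁ τ) (z - t)) := by
      filter_upwards [Metric.isOpen_ball.mem_nhds h0mem] with x hx
      have hx₁ := theta₁_ne_zero τ (hmem hx)
      have hx₂ := theta₁_ne_zero τ (hmem' hx)
      have he : HasDerivAt (fun t : ℂ ↦ cexp (-(κ * t ^ 2)))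
          (cexp (-(κ * x ^ 2)) * -(κ * (2 * x))) x := by
        simpa using ((hasDerivAt_pow 2 x).const_mul κ).neg.cexp
      have hd₁ : HasDerivAt (fun t ↦ theta₁ τ (z + t)) (deriv (theta₁ τ) (z + x)) x :=
        (hθ (z + x)).hasDerivAt.comp_const_add z x
      have hd₂ : HasDerivAt (fun t ↦ theta₁ τ (z - t)) (-deriv (theta₁ τ) (z - x)) x :=
        (hθ (z - x)).hasDerivAt.comp_const_sub z x
      rw [logDeriv_apply, (he.fun_mul ((hd₁.fun_mul hd₂).div_const _)).deriv, logDeriv_apply,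
        logDeriv_apply]
      have := exp_ne_zero (-(κ * x ^ 2))
      field_simp
      ring
    refine heq.deriv.trans ?_
    filter_upwards [Metric.isOpen_ball.mem_nhds h0mem] with x hx
    have hd₁ := (hd (hmem hx)).comp_const_add z x
    have hd₂ := (hd (hmem' hx)).comp_const_sub z x
    have hd₃ := ((hasDerivAt_id x).const_mul (2 * κ)).fun_neg
    refine ((hd₃.fun_add (hd₁.fun_sub hd₂)).deriv).trans ?_
    ring
  obtain ⟨b, hb, hs⟩ := exists_log_hasSum_of_even (r := r) hr
    (f := fun t ↦ cexp (-(κ * t ^ 2)) * (theta₁ τ (z + t) * theta₁ τ (z - t) / theta₁ τ z ^ 2))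
    (h := fun t ↦ -(wp τ (z + t) + wp τ (z - t))) (by fun_prop)
    (fun t ht ↦ mul_ne_zero (exp_ne_zero _) (div_ne_zero (mul_ne_zero
      (theta₁_ne_zero τ (hmem ht)) (theta₁_ne_zero τ (hmem' ht))) (pow_ne_zero 2 hθz)))
    (by
      simp only [add_zero, sub_zero]
      field_simp
      simp)
    (fun t ↦ by simp only [even_two.neg_pow, ← sub_eq_add_neg, sub_neg_eq_add, mul_comm])
    (fun t ↦ by simp only [← sub_eq_add_neg, sub_neg_eq_add, add_comm (wp τ (z - t))]) hh ht
  refine ⟨b, hb, hs.congr_fun fun n ↦ ?_⟩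
  have hc : ContDiffAt ℂ (2 * n : ℕ) (wp τ) z :=
    ((tauPair τ).analyticOnNhd_weierstrassP z hzΛ).contDiffAt
  have hc₁ : ContDiffAt ℂ (2 * n : ℕ) (fun t ↦ wp τ (z + t)) 0 :=
    ContDiffAt.comp (g := wp τ) 0 (by simpa using hc) (by fun_prop)
  have hc₂ : ContDiffAt ℂ (2 * n : ℕ) (fun t ↦ wp τ (z - t)) 0 :=
    ContDiffAt.comp (g := wp τ) 0 (by simpa using hc) (by fun_prop)
  rw [iteratedDeriv_fun_neg, iteratedDeriv_fun_add hc₁ hc₂, iteratedDeriv_comp_const_add,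
    iteratedDeriv_comp_const_sub]
  simp
  ring

/-- Here the second logarithmic derivative is `2(℘(t) - t⁻²)`, and `2 (2m-1)! G_{2m} / (2m)! =
G_{2m} / m` gives the coefficients. -/
theorem exists_log_dslope_theta₁_hasSum {κ : ℂ}
    (hκ : ∀ᶠ z in 𝓝 0, deriv (logDeriv φ) z = κ - (tauPair τ).weierstrassPExcept 0 z) {r : ℝ}
    (hr : 0 < r) (hL : ∀ l ∈ (tauPair τ).lattice, l ≠ 0 → r ≤ ‖l‖) {t : ℂ}
    (ht : t ∈ Metric.ball 0 r) :
    ∃ b : ℂ, cexp b = cexp (κ * t ^ 2) * (deriv (theta₁ τ) 0 ^ 2 / φ t ^ 2) ∧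
      HasSum (fun n : ℕ ↦ t ^ (2 * (n + 2)) / ((n : ℂ) + 2) * (tauPair τ).G (2 * (n + 2))) b := by
  have hφ := differentiable_dslope_theta₁ τ
  have hd0 := deriv_theta₁_zero_ne_zero τ
  have hne {t : ℂ} (ht : t ∈ Metric.ball 0 r) : φ t ≠ 0 := by
    rcases eq_or_ne t 0 with rfl | h0
    · simpa using hd0
    · have : t ∉ (tauPair τ).lattice := fun h ↦ by
        rw [mem_ball_zero_iff] at ht
        exact ht.not_ge (hL t h h0)
      have := theta₁_ne_zero τ this
      rw [theta₁_eq_mul_dslope] at this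
      exact right_ne_zero_of_mul this
  have h0mem : (0 : ℂ) ∈ Metric.ball 0 r := by simpa
  have hh : deriv (logDeriv fun t ↦ cexp (κ * t ^ 2) * (deriv (theta₁ τ) 0 ^ 2 / φ t ^ 2)) =ᶠ[𝓝 0]
      fun t ↦ 2 * (tauPair τ).weierstrassPExcept 0 t := by
    have heq : logDeriv (fun t ↦ cexp (κ * t ^ 2) * (deriv (theta₁ τ) 0 ^ 2 / φ t ^ 2)) =ᶠ[𝓝 0]
        fun t ↦ 2 * κ * t - 2 * logDeriv φ t := by
      filter_upwards [Metric.isOpen_ball.mem_nhds h0mem] with x hx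
      have hx := hne hx
      have he : HasDerivAt (fun t : ℂ ↦ cexp (κ * t ^ 2))
          (cexp (κ * x ^ 2) * (κ * (2 * x))) x := by
        simpa using ((hasDerivAt_pow 2 x).const_mul κ).cexp
      have hd₁ := (hasDerivAt_const x (deriv (theta₁ τ) 0 ^ 2)).fun_div
        ((hφ x).hasDerivAt.fun_pow 2) (pow_ne_zero 2 hx)
      rw [logDeriv_apply, (he.fun_mul hd₁).deriv, logDeriv_apply]
      have := exp_ne_zero (κ * x ^ 2)
      field_simp
      ring
    refine heq.deriv.trans ?_
    filter_upwards [Metric.isOpen_ball.mem_nhds h0mem, hκ] with x hx hκx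
    have hd : DifferentiableAt ℂ (logDeriv φ) x := (hφ.deriv x).div (hφ x) (hne hx)
    have hd₃ := (hasDerivAt_id x).const_mul (2 * κ)
    refine ((hd₃.fun_sub (hd.hasDerivAt.const_mul 2)).deriv).trans ?_
    rw [hκx]
    ring
  obtain ⟨b, hb, hs⟩ := exists_log_hasSum_of_even (r := r) hr
    (f := fun t ↦ cexp (κ * t ^ 2) * (deriv (theta₁ τ) 0 ^ 2 / φ t ^ 2))
    (h := fun t ↦ 2 * (tauPair τ).weierstrassPExcept 0 t)
    (by
      refine DifferentiableOn.mul (by fun_prop) (DifferentiableOn.div (by fun_prop) (by fun_prop)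
        fun x hx ↦ pow_ne_zero 2 (hne hx)))
    (fun t ht ↦ mul_ne_zero (exp_ne_zero _) (div_ne_zero (pow_ne_zero 2 hd0)
      (pow_ne_zero 2 (hne ht))))
    (by simp [hd0])
    (fun t ↦ by rw [even_two.neg_pow, dslope_theta₁_neg])
    (fun t ↦ by rw [PeriodPair.weierstrassPExcept_neg, neg_zero]) hh ht
  refine ⟨b, hb, ?_⟩
  -- The `t²` term is zero because `℘(t) - t⁻²` vanishes at `0`, so the sum starts at `t⁴`.
  rw [← hasSum_nat_add_iff' 1] at hs
  simp only [Finset.range_one, Finset.sum_singleton, mul_zero, iteratedDeriv_zero,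
    PeriodPair.weierstrassPExcept_zero, sub_zero] at hs
  refine hs.congr_fun fun n ↦ ?_
  have hc : ContDiffAt ℂ (2 * (n + 1) : ℕ) ((tauPair τ).weierstrassPExcept 0) 0 :=
    ((tauPair τ).analyticAt_weierstrassPExcept 0).contDiffAt
  rw [iteratedDeriv_const_mul_field, PeriodPair.iteratedDeriv_weierstrassPExcept_self,
    if_neg (by omega), PeriodPair.sumInvPow_zero, show n + 1 + 1 = n + 2 by ring,
    show 2 * (n + 2) = 2 * (n + 1) + 1 + 1 by ring, Nat.factorial_succ (2 * (n + 1) + 1)]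
  have : ((2 * (n + 1) + 1).factorial : ℂ) ≠ 0 := by exact_mod_cast Nat.factorial_ne_zero _
  have : (n : ℂ) + 2 ≠ 0 := by exact_mod_cast (by omega : n + 2 ≠ 0)
  push_cast
  rw [show (2 * ((n : ℂ) + 1) + 1 + 1) = 2 * (n + 2) by ring]
  field_simp

end Expansion

/-! ### The two identities -/

theorem mainTheorem3 (τ : UpperHalfPlane) (z : ℂ) (hz : z ∉ (tauPair τ).lattice) :
    (∀ t : ℂ,
      (∀ l ∈ (tauPair τ).lattice, ‖t‖ < ‖z - l‖) →
      (∀ l ∈ (tauPair τ).lattice, l ≠ 0 → ‖t‖ < ‖l‖) →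
      -- the sum over `n ≥ 1` is indexed by `n - 1`, the sums over `n ≥ 2` by `n - 2`
      Summable (fun n : ℕ => t ^ (2 * (n + 1)) / (Nat.factorial (2 * (n + 1)) : ℂ) *
        iteratedDeriv (2 * n) (wp τ) z) ∧
      Summable (fun n : ℕ => t ^ (2 * (n + 2)) / ((n : ℂ) + 2) * eisG (n + 2) τ) ∧
      Summable (fun n : ℕ => (2 * ((n : ℂ) + 2) - 1) * eisG (n + 2) τ * t ^ (2 * (n + 2))) ∧
      Complex.exp (-2 * ∑' n : ℕ, t ^ (2 * (n + 1)) / (Nat.factorial (2 * (n + 1)) : ℂ) *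
          iteratedDeriv (2 * n) (wp τ) z) *
        Complex.exp (∑' n : ℕ, t ^ (2 * (n + 2)) / ((n : ℂ) + 2) * eisG (n + 2) τ) =
      1 - wp τ z * t ^ 2 +
        ∑' n : ℕ, (2 * ((n : ℂ) + 2) - 1) * eisG (n + 2) τ * t ^ (2 * (n + 2))) ∧
    (∀ t : ℂ, t ∉ (tauPair τ).lattice →
      wp τ t - wp τ z =
        -(2 * (Real.pi : ℂ)) ^ 2 * (theta₁ τ z / ModularForm.eta (τ : ℂ) ^ 3) ^ (-2 : ℤ) *
          (theta₁ τ (z + t) * theta₁ τ (z - t) / (theta₁ τ t * theta₁ τ (-t)))) := by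
  have hθz := theta₁_ne_zero τ hz
  refine ⟨fun t htz ht ↦ ?_, fun t ht ↦ ?_⟩
  · obtain ⟨r₁, hr₁, h₁⟩ := (tauPair τ).isClosed_lattice.exists_gt_forall_le_dist
      (x := z) (c := ‖t‖) fun l hl ↦ by simpa [dist_eq_norm] using htz l hl
    obtain ⟨r₂, hr₂, h₂⟩ := ((tauPair τ).isClosed_of_subset_lattice
      (Set.sdiff_subset (t := {0}))).exists_gt_forall_le_dist
      (x := 0) (c := ‖t‖) fun l hl ↦ by simpa using ht l hl.1 hl.2
    have hr₁0 := (norm_nonneg t).trans_lt hr₁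
    have hr₂0 := (norm_nonneg t).trans_lt hr₂
    have hL (l : ℂ) (hl : l ∈ (tauPair τ).lattice) (h0 : l ≠ 0) : r₂ ≤ ‖l‖ := by
      simpa using h₂ l ⟨hl, h0⟩
    obtain ⟨κ, hκ₁, hκ₂⟩ := exists_deriv_logDeriv_theta₁ τ
    obtain ⟨b, hb, hsb⟩ := exists_log_theta₁_hasSum τ hκ₁ hr₁0
      (fun l hl ↦ by simpa [dist_eq_norm] using h₁ l hl) (mem_ball_zero_iff.mpr hr₁)
    obtain ⟨c, hc, hsc⟩ := exists_log_dslope_theta₁_hasSum τ hκ₂ hr₂0 hL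
      (mem_ball_zero_iff.mpr hr₂)
    have hsG := (tauPair τ).hasSum_sq_mul_weierstrassPExcept hL (mem_ball_zero_iff.mpr hr₂)
    have hsb' : HasSum (fun n : ℕ => t ^ (2 * (n + 1)) / (Nat.factorial (2 * (n + 1)) : ℂ) *
        iteratedDeriv (2 * n) (wp τ) z) (-1 / 2 * b) :=
      (hsb.mul_left (-1 / 2)).congr_fun fun n ↦ by ring
    simp only [eisG_eq_G τ (Nat.le_add_left 2 _)]
    refine ⟨hsb'.summable, hsc.summable, hsG.summable, ?_⟩
    rw [hsb'.tsum_eq, hsc.tsum_eq, hsG.tsum_eq, show -2 * (-1 / 2 * b) = b by ring, hb, hc,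
      Complex.exp_neg]
    have he := exp_ne_zero (κ * t ^ 2)
    -- The theta quotient formula needs `t ∉ Λ`, so `t = 0` is checked directly.
    rcases eq_or_ne t 0 with rfl | h0
    · have := deriv_theta₁_zero_ne_zero τ
      simp
      field_simp
    · have htΛ : t ∉ (tauPair τ).lattice := fun h ↦ (ht t h h0).false
      have h := wp_sub_wp τ hz htΛ
      have hθt := theta₁_ne_zero τ htΛ
      rw [theta₁_eq_mul_dslope τ t] at h hθt
      have hφt := right_ne_zero_of_mul hθt
      rw [wp_eq_weierstrassPExcept_add τ t] at h
      have h' : 1 - wp τ z * t ^ 2 + t ^ 2 * (tauPair τ).weierstrassPExcept 0 t =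
          t ^ 2 * ((tauPair τ).weierstrassPExcept 0 t + 1 / t ^ 2 - wp τ z) := by
        field_simp
        ring
      rw [h', h]
      field_simp
  · have hη := eta_ne_zero τ
    have hθt := theta₁_ne_zero τ ht
    rw [wp_sub_wp τ hz ht, deriv_theta₁_zero, theta₁_neg, zpow_neg, zpow_ofNat]
    field_simp
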